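/- Let $\mathbb{F}_q$ be a finite field of characteristic $p$, let $H$ be a finite group with $p \mid |H|$, let $A=\mathbb{F}_qH$ be the group algebra, $J(A)$ its Jacobson radical and $\overline{A}=A/J(A)$, with $\overline{x}=x+J(A)$ for $x\in A$. Ideals are left ideals unless stated otherwise. An idempotent is primitive if it is nonzero and is not a sum of two nonzero orthogonal idempotents. A principal indecomposable module of $A$ is a left ideal $Ae$ generated by a primitive idempotent $e$; a left ideal of $A$ is ECD if it is generated by an idempotent and has $\mathbb{F}_q$-dimension at most $p$; and $A$ is ECID if all its principal indecomposable modules are ECD. Let $\overline{A}=\bigoplus_{j=1}^{m}B_j$ be the decomposition of $\overline{A}$ into its simple components (two-sided ideals that are simple rings), where $B_j\cong M_{n_j}(F_j)$ as $\mathbb{F}_q$-algebras for field extensions $F_j$ of $\mathbb{F}_q$. For each $j$ let $f_j\in B_j$ and $e_j\in A$ be primitive idempotents with $\overline{e_j}=f_j$. Then the following are equivalent: 1. $A$ is an ECID group algebra. 2. Every primitive idempotent $e$ of $A$ generates a left ideal $Ae$ with $\dim_{\mathbb{F}_q}(Ae)=p$. 3. $\dim_{\mathbb{F}_q}(\overline{A}f_j)=p-\dim_{\mathbb{F}_q}(J(A)e_j)$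 for all $j$. 4. $\dim_{\mathbb{F}_q}(J(A)e_j)=p-n_j\,[F_j:\mathbb{F}_q]$ for all $j$. -/

import Mathlib

/-- A primitive idempotent of a ring: a nonzero idempotent that is not the sum of two nonzero
orthogonal idempotents. -/
def IsPrimitiveIdempotent {R : Type*} [Ring R] (e : R) : Prop :=
  e ≠ 0 ∧ IsIdempotentElem e ∧
    ∀ x y : R, IsIdempotentElem x → IsIdempotentElem y → x * y = 0 → y * x = 0 →
      e = x + y → x = 0 ∨ y = 0

/-- A principal indecomposable module of `R`: a left ideal `R e` generated by a primitive
idempotent `e`. -/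
def IsPrincipalIndecomposable {R : Type*} [Ring R] (I : Ideal R) : Prop :=
  ∃ e : R, IsPrimitiveIdempotent e ∧ I = Ideal.span {e}

/-- A left ideal of a `K`-algebra is ECD (of easily computable dimension) if it is generated by
an idempotent and its dimension over `K` is at most the characteristic of `K`. -/
def IsECD (K : Type*) {R : Type*} [Field K] [Ring R] [Algebra K R] (I : Ideal R) : Prop :=
  (∃ e : R, IsIdempotentElem e ∧ I = Ideal.span {e}) ∧ Module.finrank K I ≤ ringChar K

/-- A `K`-algebra is ECID (of easily computable indecomposable dimension) if all of its principal
indecomposable modules are ECD. -/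
def IsECID (K R : Type*) [Field K] [Ring R] [Algebra K R] : Prop :=
  ∀ I : Ideal R, IsPrincipalIndecomposable I → IsECD K I

/-- For a left ideal `J` and an element `e`, the left ideal `J e = {x * e | x ∈ J}`. -/
def Ideal.mulElem {R : Type*} [Ring R] (J : Ideal R) (e : R) : Ideal R :=
  Submodule.map (LinearMap.toSpanSingleton R R e) J

/-- The elements of `J e` are exactly the products `x * e` with `x ∈ J`. -/
theorem Ideal.mem_mulElem {R : Type*} [Ring R] {J : Ideal R} {e y : R} :
    y ∈ J.mulElem e ↔ ∃ x ∈ J, x * e = y := by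
  simp [Ideal.mulElem, Submodule.mem_map]

/-! The key fact is that `p` divides the dimension of every projective left ideal of `KH`. Take `g`
in `H` of order `p`. The group algebra is free over `K⟨g⟩ ≅ K[y]/(y^p)` with `y = g - 1`, so on a
direct summand all Jordan blocks of `y` have size `p`. A nonzero projective left ideal of dimension
at most `p` therefore has dimension exactly `p`.

It remains to compute with the given `e j`. Modulo the radical `J`, every primitive idempotent `x`
meets some component, and lifting this makes `Ax` and `A(e j)` equidimensional. Finally `dim A(e j)
= dim Ā(f j) + dim J(e j)`, and `Ā(f j)` is a copy of the column space `(F j)^(n j)`. -/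

/-! ### Divisibility by `p` of the dimensions of projective left ideals -/

section Dimension

/-- If an endomorphism `y` with `y ^ n = 0` satisfies `ker y ≤ range (y ^ (n - 1))`, then all its
Jordan blocks have size `n`. -/
theorem Module.End.finrank_eq_mul_finrank_ker {K V : Type*} [Field K] [AddCommGroup V] [Module K V]
    [FiniteDimensional K V] (y : Module.End K V) (n : ℕ) (hy : y ^ n = 0)
    (h : LinearMap.ker y ≤ LinearMap.range (y ^ (n - 1))) :
    Module.finrank K V = n * Module.finrank K (LinearMap.ker y) := by
  have key : ∀ i ≤ n, Module.finrank K (LinearMap.ker (y ^ i)) =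
      i * Module.finrank K (LinearMap.ker y) := by
    intro i
    induction i with
    | zero => simp [Module.End.one_eq_id]
    | succ i ih =>
      intro hi
      -- `T` has kernel `ker (y ^ i)` and image `ker y`, so each step adds `dim ker y`.
      let T := (y ^ i).domRestrict (LinearMap.ker (y ^ (i + 1)))
      have hle : LinearMap.ker (y ^ i) ≤ LinearMap.ker (y ^ (i + 1)) := by
        intro v hv
        rw [LinearMap.mem_ker] at hv ⊢
        rw [pow_succ', Module.End.mul_apply, hv, map_zero]
      have hker : LinearMap.ker T =
          (LinearMap.ker (y ^ i)).comap (LinearMap.ker (y ^ (i + 1))).subtype := by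
        ext v
        simp [T, LinearMap.mem_ker]
      have hrange : LinearMap.range T = LinearMap.ker y := by
        ext v
        constructor
        · rintro ⟨⟨w, hw⟩, rfl⟩
          rw [LinearMap.mem_ker, pow_succ', Module.End.mul_apply] at hw
          exact hw
        · intro hv
          obtain ⟨w, rfl⟩ := h hv
          refine ⟨⟨(y ^ (n - 1 - i)) w, ?_⟩, ?_⟩
          · rw [LinearMap.mem_ker, ← Module.End.mul_apply, ← pow_add,
              show i + 1 + (n - 1 - i) = n by omega, hy, LinearMap.zero_apply]
          · change (y ^ i) ((y ^ (n - 1 - i)) w) = _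
            rw [← Module.End.mul_apply, ← pow_add, show i + (n - 1 - i) = n - 1 by omega]
      have := LinearMap.finrank_range_add_finrank_ker T
      rw [hker, hrange, (Submodule.comapSubtypeEquivOfLe hle).finrank_eq, ih (by omega)] at this
      rw [← this]
      ring
  have h1 := key n le_rfl
  rw [hy, LinearMap.ker_zero, finrank_top] at h1
  exact h1

/-- In `K[X]`, both sides multiplied by `X - 1` give `X ^ p - 1 = (X - 1) ^ p`. -/
theorem geom_sum_eq_sub_one_pow {K A : Type*} [Field K] [Ring A] [Algebra K A] (p : ℕ)
    [Fact p.Prime] [CharP K p] (a : A) :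
    ∑ i ∈ Finset.range p, a ^ i = (a - 1) ^ (p - 1) := by
  open Polynomial in
  have h : (∑ i ∈ Finset.range p, (X : K[X]) ^ i) = (X - 1) ^ (p - 1) := by
    have h1 : (X - 1 : K[X]) ≠ 0 := by
      simpa using X_sub_C_ne_zero (1 : K)
    apply mul_right_cancel₀ h1
    rw [geom_sum_mul, ← pow_succ, Nat.sub_add_cancel (Fact.out : p.Prime).one_le, sub_pow_char,
      one_pow]
  simpa using congrArg (Polynomial.aeval a) h

/-- In the regular representation of a group algebra, the invariants of a cyclic group are
traces. -/
theorem MonoidAlgebra.exists_geom_sum_mul_eq {K H : Type*} [Field K] [Group H] [Finite H] (g : H)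
    (v : MonoidAlgebra K H) (hv : single g 1 * v = v) :
    ∃ w, (∑ i ∈ Finset.range (orderOf g), single g (1 : K) ^ i) * w = v := by
  classical
  -- An invariant `v` is constant on the cosets `⟨g⟩h`, so it is the trace of its restriction to a
  -- transversal `T`: at each `h` exactly one translate contributes.
  obtain ⟨T, hT, -⟩ := Subgroup.exists_isComplement_right (Subgroup.zpowers g) 1
  have hpow : ∀ i : ℕ, single g (1 : K) ^ i * v = v := by
    intro i
    induction i with
    | zero => simp
    | succ i ih => rw [pow_succ, mul_assoc, hv, ih]
  have hcoeff : ∀ (i : ℕ) (h : H), v.coeff ((g ^ i)⁻¹ * h) = v.coeff h := by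
    intro i h
    conv_rhs => rw [← hpow i, single_pow, one_pow, coeff_single_mul_apply, one_mul]
  refine ⟨ofCoeff (v.coeff.filter (· ∈ T)), ?_⟩
  ext h
  obtain ⟨⟨⟨z, hz⟩, t⟩, hzt, huniq⟩ := hT.existsUnique h
  obtain ⟨k, hk, rfl⟩ := (mem_zpowers_iff_mem_range_orderOf.1 hz |> Finset.mem_image.1)
  have hmem : ∀ i ∈ Finset.range (orderOf g), (g ^ i)⁻¹ * h ∈ T → i = k := by
    intro i hi hiT
    have := huniq ⟨⟨g ^ i, Subgroup.npow_mem_zpowers g i⟩, ⟨_, hiT⟩⟩ (by simp)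
    have h2 : g ^ i = g ^ k := congrArg (fun x => (x.1 : H)) this
    exact pow_injOn_Iio_orderOf (by simpa using hi) (by simpa using hk) h2
  have hk2 : (g ^ k)⁻¹ * h ∈ T := by
    have : (g ^ k)⁻¹ * h = t := by rw [← hzt]; simp
    rw [this]; exact t.2
  rw [Finset.sum_mul, coeff_sum, Finsupp.finsetSum_apply, Finset.sum_eq_single k]
  · rw [single_pow, one_pow, coeff_single_mul_apply, one_mul, coeff_ofCoeff,
      Finsupp.filter_apply_pos _ _ hk2, hcoeff]
  · intro i hi hik
    rw [single_pow, one_pow, coeff_single_mul_apply, one_mul, coeff_ofCoeff,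
      Finsupp.filter_apply_neg]
    exact fun hh => hik (hmem i hi hh)
  · exact fun hh => absurd hk hh

/-- The dimension of a projective left ideal of a group algebra in characteristic `p` is divisible
by `p` if `p` divides the order of the group. -/
theorem MonoidAlgebra.dvd_finrank_span_idempotent {K H : Type*} [Field K] [Group H] [Finite H]
    (p : ℕ) [Fact p.Prime] [CharP K p] (hp : p ∣ Nat.card H) {e : MonoidAlgebra K H}
    (he : IsIdempotentElem e) : p ∣ Module.finrank K (Ideal.span {e}) := by
  obtain ⟨g, hg⟩ := exists_prime_orderOf_dvd_card' p hp
  set a : MonoidAlgebra K H := single g 1 with ha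
  let V := Ideal.span {e}
  let y : Module.End K V := Algebra.lsmul K K V (a - 1)
  have hyk : ∀ (k : ℕ) (v : V), (((y ^ k) v : V) : MonoidAlgebra K H) = (a - 1) ^ k * v := by
    intro k v
    simp only [y, ← map_pow]
    rfl
  have hchar : CharP (MonoidAlgebra K H) p := charP_of_injective_algebraMap
    (algebraMap K (MonoidAlgebra K H)).injective p
  have hyp : y ^ p = 0 := by
    simp only [y, ← map_pow]
    rw [sub_pow_char_of_commute _ (Commute.one_right a), ha, single_pow, ← hg, pow_orderOf_eq_one,
      one_pow, one_pow, ← one_def, sub_self, map_zero]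
  refine ⟨_, y.finrank_eq_mul_finrank_ker p hyp ?_⟩
  intro v hv
  have hv1 : a * v = (v : MonoidAlgebra K H) := by
    have := hyk 1 v
    rw [pow_one, LinearMap.mem_ker.1 hv] at this
    simpa [sub_mul, sub_eq_zero, eq_comm] using this
  obtain ⟨w, hw⟩ := exists_geom_sum_mul_eq g _ hv1
  have hve : (v : MonoidAlgebra K H) * e = v := by
    obtain ⟨c, hc⟩ := Ideal.mem_span_singleton'.1 v.2
    rw [← hc, mul_assoc, he.eq]
  -- Right multiplication by `e` moves the preimage `w` into `V`, commutes with the left action and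
  -- fixes `v`.
  refine ⟨⟨w * e, Ideal.mem_span_singleton'.2 ⟨w, rfl⟩⟩, Subtype.ext ?_⟩
  rw [hyk, ← geom_sum_eq_sub_one_pow (K := K) p, ← mul_assoc, ← hg, hw, hve]

end Dimension

/-! ### Primitive idempotents and reduction modulo the radical -/

section Idempotents

variable {K R : Type*} [Field K] [Ring R] [Algebra K R]

theorem mul_eq_self_of_mem_span_idempotent {e a : R} (he : IsIdempotentElem e)
    (ha : a ∈ Ideal.span {e}) : a * e = a := by
  obtain ⟨c, rfl⟩ := Ideal.mem_span_singleton'.1 ha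
  rw [mul_assoc, he.eq]

/-- In a semisimple ring, a primitive idempotent generates a minimal left ideal. -/
theorem IsPrimitiveIdempotent.exists_mul_eq [IsSemisimpleRing R] {f u : R}
    (hf : IsPrimitiveIdempotent f) (hu : u ≠ 0) (huf : u * f = u) : ∃ v, v * u = f := by
  obtain ⟨hf0, hfi, hfp⟩ := hf
  have hU : ∀ a ∈ Ideal.span {u}, a * f = a := by
    intro a ha
    obtain ⟨c, rfl⟩ := Ideal.mem_span_singleton'.1 ha
    rw [mul_assoc, huf]
  -- The components of `f` along `Ru ⊕ N` are orthogonal idempotents, so one of them vanishes; if it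
  -- is the one in `Ru`, then `u = u * f` lies in `N`, hence is zero.
  obtain ⟨N, hN⟩ := exists_isCompl (Ideal.span {u})
  obtain ⟨a, ha, b', hb', hab'⟩ := Submodule.mem_sup.1
    (show f ∈ Ideal.span {u} ⊔ N by rw [hN.sup_eq_top]; trivial)
  have haf := hU a ha
  have hbf : b' * f = b' := by
    have : b' = f - a := by rw [← hab']; abel
    rw [this, sub_mul, haf, hfi.eq]
  have hzero : ∀ z, z ∈ Ideal.span {u} → z ∈ N → z = 0 := fun z h1 h2 =>
    (Submodule.disjoint_def.1 hN.disjoint) z h1 h2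
  have h1 : a * a + a * b' = a := by rw [← mul_add, hab', haf]
  have h2 : b' * a + b' * b' = b' := by rw [← mul_add, hab', hbf]
  have hab0 : a * b' = 0 := hzero _
    (by rw [eq_sub_of_add_eq' h1]; exact sub_mem ha (Ideal.mul_mem_left _ _ ha))
    (Ideal.mul_mem_left _ _ hb')
  have hba0 : b' * a = 0 := hzero _ (Ideal.mul_mem_left _ _ ha)
    (by rw [eq_sub_of_add_eq h2]; exact sub_mem hb' (Ideal.mul_mem_left _ _ hb'))
  rw [hab0, add_zero] at h1
  rw [hba0, zero_add] at h2
  rcases hfp a b' h1 h2 hab0 hba0 hab'.symm with h | h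
  · rw [h, zero_add] at hab'
    refine absurd (hzero u (Ideal.mem_span_singleton_self u) ?_) hu
    rw [← huf, ← hab']
    exact Ideal.mul_mem_left _ _ hb'
  · rw [h, add_zero] at hab'
    exact Ideal.mem_span_singleton'.1 (hab' ▸ ha)

/-- Right multiplication by `u` maps `Rx` into `Re`; following it with `v` gives the identity on
`Rx`, so it is injective. -/
theorem finrank_span_le_of_mul_eq [FiniteDimensional K R] {x e u v : R} (hx : IsIdempotentElem x)
    (huv : u * v = x) (hvu : v * u = e) :
    Module.finrank K (Ideal.span {x}) ≤ Module.finrank K (Ideal.span {e}) := by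
  have hmem : ∀ a ∈ Ideal.span {x}, LinearMap.toSpanSingleton R R u a ∈ Ideal.span {e} := by
    intro a ha
    obtain ⟨c, rfl⟩ := Ideal.mem_span_singleton'.1 ha
    refine Ideal.mem_span_singleton'.2 ⟨c * u, ?_⟩
    rw [LinearMap.toSpanSingleton_apply, smul_eq_mul, ← hvu, ← huv]
    simp only [mul_assoc]
  have : FiniteDimensional K (Ideal.span {e}) :=
    inferInstanceAs (FiniteDimensional K ((Ideal.span {e}).restrictScalars K))
  refine LinearMap.finrank_le_finrank_of_injective
    (f := ((LinearMap.toSpanSingleton R R u).restrict hmem).restrictScalars K) ?_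
  rw [injective_iff_map_eq_zero]
  rintro ⟨a, ha⟩ h
  have h0 : a * u = 0 := congrArg Subtype.val h
  apply Subtype.ext
  change a = 0
  rw [← mul_eq_self_of_mem_span_idempotent hx ha, ← huv, ← mul_assoc, h0, zero_mul]

/-- If a primitive idempotent `x` shares a composition factor modulo the Jacobson radical with an
idempotent `e` in the sense of the hypothesis `h`, then `R x` and `R e` have the same dimension. -/
theorem IsPrimitiveIdempotent.finrank_span_eq [FiniteDimensional K R] {x e u v : R}
    (hx : IsPrimitiveIdempotent x) (he : IsIdempotentElem e) (he0 : e ≠ 0)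
    (hxu : x * u = u) (hue : u * e = u) (h : e - v * u ∈ Ring.jacobson R) :
    Module.finrank K (Ideal.span {x}) = Module.finrank K (Ideal.span {e}) := by
  -- `1 - (e - v * u)` has a left inverse `w` and sends `e` to `v * u`, whence `w * v * u = e`.
  obtain ⟨w, hw⟩ := Ideal.exists_mul_sub_mem_of_sub_one_mem_jacobson (I := (⊥ : Ideal R))
    (1 - (e - v * u)) (by
      rw [Ideal.jacobson_bot, sub_sub_cancel_left]
      exact neg_mem h)
  rw [Ideal.mem_bot, sub_eq_zero] at hw
  have hwe : w * v * u = e := by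
    have : (1 - (e - v * u)) * e = v * u := by
      rw [sub_mul, sub_mul, he.eq, mul_assoc, hue, one_mul, sub_sub_cancel]
    rw [mul_assoc, ← this, ← mul_assoc, hw, one_mul]
  set V := e * (w * v) * x with hV
  have hVu : V * u = e := by
    rw [hV, mul_assoc, hxu, mul_assoc, hwe, he.eq]
  have heV : e * V = V := by rw [hV, ← mul_assoc, ← mul_assoc, he.eq]
  have hVx : V * x = V := by rw [hV, mul_assoc, hx.2.1.eq]
  have hi : IsIdempotentElem (u * V) := by
    change u * V * (u * V) = u * V
    rw [mul_assoc, ← mul_assoc V, hVu, heV]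
  have hl : x * (u * V) = u * V := by rw [← mul_assoc, hxu]
  have hr : u * V * x = u * V := by rw [mul_assoc, hVx]
  -- `u * V` is an idempotent of `xRx`, nonzero because `V * u = e`; primitivity of `x` forces
  -- equality.
  have huV : u * V = x := by
    rcases hx.2.2 (u * V) (x - u * V) hi
      (by
        change (x - u * V) * (x - u * V) = _
        rw [mul_sub, sub_mul, sub_mul, hl, hr, hi.eq, hx.2.1.eq]; abel)
      (by rw [mul_sub, hr, hi.eq, sub_self]) (by rw [sub_mul, hl, hi.eq, sub_self])
      (by abel) with h | h
    · refine absurd ?_ he0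
      rw [← he.eq, ← hVu, mul_assoc, ← mul_assoc u, h, zero_mul, mul_zero]
    · exact (sub_eq_zero.1 h).symm
  exact le_antisymm (finrank_span_le_of_mul_eq hx.2.1 huV hVu)
    (finrank_span_le_of_mul_eq he hVu huV)

/-- Rank-nullity for reduction on `Re`: an `a` in `Re` that lies in `J` equals `a * e`, hence lies
in `Je`. -/
theorem finrank_span_eq_finrank_quotient_add [FiniteDimensional K R] (J : Ideal R) [J.IsTwoSided]
    {e : R} (he : IsIdempotentElem e) :
    Module.finrank K (Ideal.span {e}) =
      Module.finrank K (Ideal.span {Ideal.Quotient.mk J e}) + Module.finrank K (J.mulElem e) := by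
  let S : Submodule K R := (Ideal.span {e}).restrictScalars K
  let N : Submodule K R := (J.mulElem e).restrictScalars K
  let T := (Ideal.Quotient.mkₐ K J).toLinearMap.domRestrict S
  have hNS : N ≤ S := by
    intro y hy
    obtain ⟨x, -, rfl⟩ := Ideal.mem_mulElem.1 hy
    exact Ideal.mem_span_singleton'.2 ⟨x, rfl⟩
  have hrange : LinearMap.range T =
      (Ideal.span {Ideal.Quotient.mk J e}).restrictScalars K := by
    ext y
    constructor
    · rintro ⟨⟨a, ha⟩, rfl⟩
      obtain ⟨c, rfl⟩ := Ideal.mem_span_singleton'.1 ha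
      exact Ideal.mem_span_singleton'.2 ⟨Ideal.Quotient.mk J c, (map_mul _ _ _).symm⟩
    · intro hy
      obtain ⟨c, rfl⟩ := Ideal.mem_span_singleton'.1 hy
      obtain ⟨c, rfl⟩ := Ideal.Quotient.mk_surjective c
      exact ⟨⟨c * e, Ideal.mem_span_singleton'.2 ⟨c, rfl⟩⟩, map_mul (Ideal.Quotient.mk J) c e⟩
  have hker : LinearMap.ker T = N.comap S.subtype := by
    ext ⟨a, ha⟩
    change Ideal.Quotient.mk J a = 0 ↔ a ∈ J.mulElem e
    rw [Ideal.Quotient.eq_zero_iff_mem, Ideal.mem_mulElem]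
    constructor
    · exact fun h => ⟨a, h, mul_eq_self_of_mem_span_idempotent he ha⟩
    · rintro ⟨b, hb, rfl⟩
      exact J.mul_mem_right _ hb
  have := LinearMap.finrank_range_add_finrank_ker T
  rw [hrange, hker, (Submodule.comapSubtypeEquivOfLe hNS).finrank_eq] at this
  exact this.symm

end Idempotents

/-! ### Matrix components of the semisimple quotient -/

section Components

variable {K R : Type*} [Field K] [Ring R] [Algebra K R]

/-- The dimension of the left ideal generated by a primitive idempotent of a matrix component of a
semisimple algebra. -/
theorem IsPrimitiveIdempotent.finrank_span_of_matrix [IsSemisimpleRing R] {n : ℕ} {F : Type*}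
    [Field F] [Algebra K F] (φ : Matrix (Fin n) (Fin n) F →ₙₐ[K] R)
    (hφ : Function.Injective φ) (hrange : ∀ z M, z * φ M ∈ Set.range φ) {f : R}
    (hf : IsPrimitiveIdempotent f) (hfφ : f ∈ Set.range φ) :
    Module.finrank K (Ideal.span {f}) = n * Module.finrank K F := by
  obtain ⟨Y, rfl⟩ := hfφ
  have hY0 : Y ≠ 0 := by
    rintro rfl
    exact hf.1 (map_zero φ)
  have hYY : Y * Y = Y := hφ (by rw [map_mul, hf.2.1.eq])
  obtain ⟨a, b, hab⟩ : ∃ a b, Y a b ≠ 0 := by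
    by_contra! h
    exact hY0 (Matrix.ext h)
  -- Since `Y` is idempotent, its nonzero row `Y a` satisfies `Y a * Y = Y a`; so `w ↦ w ⊗ Y a`
  -- embeds the column space in `Rf`, and minimality of `Rf` gives surjectivity.
  let L : (Fin n → F) →ₗ[K] R :=
    { toFun := fun w => φ (Matrix.vecMulVec w (Y a))
      map_add' := fun w w' => by rw [Matrix.add_vecMulVec, map_add]
      map_smul' := fun c w => by rw [Matrix.smul_vecMulVec, map_smul]; rfl }
  have hL : Function.Injective L := by
    rw [injective_iff_map_eq_zero]
    intro w hw
    have h0 : Matrix.vecMulVec w (Y a) = 0 := hφ (hw.trans (map_zero φ).symm)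
    funext i
    have := congrFun (congrFun h0 i) b
    rw [Matrix.vecMulVec_apply] at this
    exact (mul_eq_zero.1 this).resolve_right hab
  have hLf : ∀ w, L w * φ Y = L w := by
    intro w
    change φ _ * φ Y = φ _
    rw [← map_mul, Matrix.vecMulVec_mul, ← Matrix.mul_apply_eq_vecMul, hYY]
  let w₀ : Fin n → F := fun _ => 1
  have hw₀ : L w₀ ≠ 0 := by
    rw [Ne, map_eq_zero_iff L hL]
    exact fun h => one_ne_zero (congrFun h a)
  obtain ⟨v, hv⟩ := hf.exists_mul_eq hw₀ (hLf w₀)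
  have hLrange : LinearMap.range L = (Ideal.span {φ Y}).restrictScalars K := by
    ext y
    constructor
    · rintro ⟨w, rfl⟩
      exact Ideal.mem_span_singleton'.2 ⟨_, hLf w⟩
    · intro hy
      obtain ⟨z, rfl⟩ := Ideal.mem_span_singleton'.1 hy
      -- `φ` is not unital, so `z * v` itself need not lie in its range; `z * v * φ 1` does, and
      -- acts in the same way on the range.
      obtain ⟨M, hM⟩ := hrange (z * v) 1
      refine ⟨M.mulVec w₀, ?_⟩
      change φ _ = _
      rw [← Matrix.mul_vecMulVec, map_mul, hM, mul_assoc, ← map_mul, one_mul]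
      change z * v * L w₀ = _
      rw [mul_assoc, hv]
  have h1 := LinearMap.finrank_range_of_inj hL
  rw [hLrange] at h1
  have h2 := Module.finrank_mul_finrank K F (Fin n → F)
  rw [Module.finrank_fin_fun] at h2
  rw [mul_comm, h2]
  exact h1

theorem TwoSidedIdeal.mul_eq_zero_of_isInternal {ι : Type*} [DecidableEq ι]
    {B : ι → TwoSidedIdeal R} (hB : DirectSum.IsInternal B) {i j : ι} (hij : i ≠ j) {a b : R}
    (ha : a ∈ B i) (hb : b ∈ B j) : a * b = 0 := by
  have hi : a * b ∈ B i := (B i).mul_mem_right _ _ ha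
  have hj : a * b ∈ B j := (B j).mul_mem_left _ _ hb
  have h : DirectSum.of (fun k => B k) i ⟨a * b, hi⟩ = DirectSum.of (fun k => B k) j ⟨a * b, hj⟩ :=
    hB.injective (by rw [DirectSum.coeAddMonoidHom_of, DirectSum.coeAddMonoidHom_of])
  have h2 := congrArg (fun d => d i) h
  simp only [DirectSum.of_eq_same, DirectSum.of_eq_of_ne _ _ _ hij] at h2
  exact congrArg Subtype.val h2

/-- A nonzero element acts nontrivially on the simple modules attached to some component. -/
theorem exists_mul_mul_ne_zero_of_isInternal {ι : Type*} [DecidableEq ι] [Fintype ι]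
    {B : ι → TwoSidedIdeal R} (hB : DirectSum.IsInternal B)
    (n : ι → ℕ) (F : ι → Type*) [∀ j, Field (F j)] [∀ j, Algebra K (F j)]
    (φ : ∀ j, Matrix (Fin (n j)) (Fin (n j)) (F j) →ₙₐ[K] R)
    (hφinj : ∀ j, Function.Injective (φ j)) (hφrange : ∀ j, Set.range (φ j) = (B j : Set R))
    (f : ι → R) (hfB : ∀ j, f j ∈ B j) (hf : ∀ j, f j ≠ 0) {x : R} (hx : x ≠ 0) :
    ∃ j c, x * c * f j ≠ 0 := by
  obtain ⟨d, rfl⟩ := hB.surjective x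
  have hd : d ≠ 0 := by
    rintro rfl
    exact hx (map_zero _)
  obtain ⟨j, hj⟩ : ∃ j, d j ≠ 0 := by
    by_contra! h
    exact hd (DFinsupp.ext h)
  have hsum : DirectSum.coeAddMonoidHom B d = ∑ i, (d i : R) := by
    conv_lhs => rw [← DirectSum.sum_univ_of d, map_sum]
    simp only [DirectSum.coeAddMonoidHom_of]
  obtain ⟨X, hX⟩ : (d j : R) ∈ Set.range (φ j) := by rw [hφrange]; exact (d j).2
  obtain ⟨Y, hY⟩ : f j ∈ Set.range (φ j) := by rw [hφrange]; exact hfB j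
  obtain ⟨a, b, hab⟩ : ∃ a b, X a b ≠ 0 := by
    by_contra! h
    refine hj (Subtype.ext ?_)
    rw [← hX, Matrix.ext (N := 0) h, map_zero]
    rfl
  obtain ⟨a', b', hab'⟩ : ∃ a b, Y a b ≠ 0 := by
    by_contra! h
    refine hf j ?_
    rw [← hY, Matrix.ext (N := 0) h, map_zero]
  -- The matrix unit makes the `(a, b')` entry of the product `X a b * Y a' b'`.
  refine ⟨j, φ j (Matrix.single b a' 1), ?_⟩
  rw [hsum, Finset.sum_mul, Finset.sum_mul, Finset.sum_eq_single j]
  · rw [← hX, ← hY, ← map_mul, ← map_mul, Ne, map_eq_zero_iff _ (hφinj j)]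
    intro h
    have := congrFun (congrFun h a) b'
    rw [Matrix.mul_assoc, Matrix.mul_apply, Finset.sum_eq_single b] at this
    · simp [hab, hab'] at this
    · intro k _ hk
      rw [Matrix.single_mul_apply_of_ne _ _ _ _ _ hk, mul_zero]
    · simp
  · intro i _ hij
    rw [mul_assoc]
    exact TwoSidedIdeal.mul_eq_zero_of_isInternal hB hij (d i).2
      ((B j).mul_mem_left _ _ (hfB j))
  · simp

end Components

/-! ### The equivalences -/

/-- Characterizations of ECID algebras among the algebras over a field of characteristic `p` whose
projective left ideals have dimension divisible by `p`. -/
theorem tfae_isECID {K : Type*} [Field K] (p : ℕ) [CharP K p] {A : Type*} [Ring A] [Algebra K A]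
    [FiniteDimensional K A]
    (hdvd : ∀ x : A, IsIdempotentElem x → p ∣ Module.finrank K (Ideal.span {x}))
    {m : ℕ} (B : Fin m → TwoSidedIdeal (A ⧸ Ring.jacobson A))
    (hB : DirectSum.IsInternal B)
    (n : Fin m → ℕ) (F : Fin m → Type*) [∀ j, Field (F j)] [∀ j, Algebra K (F j)]
    (φ : ∀ j, Matrix (Fin (n j)) (Fin (n j)) (F j) →ₙₐ[K]
      (A ⧸ Ring.jacobson A))
    (hφinj : ∀ j, Function.Injective (φ j)) (hφrange : ∀ j, Set.range (φ j) = (B j : Set _))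
    (f : Fin m → A ⧸ Ring.jacobson A)
    (hfB : ∀ j, f j ∈ B j) (hf : ∀ j, IsPrimitiveIdempotent (f j))
    (e : Fin m → A) (he : ∀ j, IsPrimitiveIdempotent (e j))
    (hef : ∀ j, Ideal.Quotient.mk (Ring.jacobson A) (e j) = f j) :
    List.TFAE [
      IsECID K A,
      ∀ x : A, IsPrimitiveIdempotent x → Module.finrank K (Ideal.span {x}) = p,
      ∀ j, (Module.finrank K (Ideal.span {f j}) : ℤ) =
        (p : ℤ) - Module.finrank K ((Ring.jacobson A).mulElem (e j)),
      ∀ j, (Module.finrank K ((Ring.jacobson A).mulElem (e j)) : ℤ) =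
        (p : ℤ) - (n j : ℤ) * Module.finrank K (F j)] := by
  classical
  have hart : IsArtinianRing A := .of_finite K A
  have hchar : ringChar K = p := ringChar.eq K p
  have hsplit : ∀ j, Module.finrank K (Ideal.span {e j}) = Module.finrank K (Ideal.span {f j}) +
      Module.finrank K ((Ring.jacobson A).mulElem (e j)) := fun j => by
    rw [← hef j]
    exact finrank_span_eq_finrank_quotient_add _ (he j).2.1
  have hdim : ∀ j, Module.finrank K (Ideal.span {f j}) = n j * Module.finrank K (F j) := fun j =>
    (hf j).finrank_span_of_matrix (φ j) (hφinj j)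
      (fun z M => by
        have hM : φ j M ∈ B j := by
          rw [← SetLike.mem_coe, ← hφrange]
          exact ⟨M, rfl⟩
        rw [hφrange]
        exact (B j).mul_mem_left _ _ hM)
      (by rw [hφrange]; exact hfB j)
  have hpos : ∀ x : A, x ≠ 0 → 0 < Module.finrank K (Ideal.span {x}) := by
    intro x hx
    have : FiniteDimensional K (Ideal.span {x}) :=
      inferInstanceAs (FiniteDimensional K ((Ideal.span {x}).restrictScalars K))
    have : Nontrivial (Ideal.span {x}) :=
      ⟨⟨x, Ideal.mem_span_singleton_self x⟩, 0, fun h => hx (congrArg Subtype.val h)⟩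
    exact Module.finrank_pos
  have hcomp : ∀ x : A, IsPrimitiveIdempotent x →
      ∃ j, Module.finrank K (Ideal.span {x}) = Module.finrank K (Ideal.span {e j}) := by
    intro x hx
    -- An idempotent `x` in the radical is zero: `1 - x` is left invertible and kills `x`.
    have hx0 : Ideal.Quotient.mk (Ring.jacobson A) x ≠ 0 := by
      intro h
      rw [Ideal.Quotient.eq_zero_iff_mem] at h
      obtain ⟨s, hs⟩ := Ideal.exists_mul_sub_mem_of_sub_one_mem_jacobson (I := (⊥ : Ideal A))
        (1 - x) (by
          rw [Ideal.jacobson_bot, sub_sub_cancel_left]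
          exact neg_mem h)
      rw [Ideal.mem_bot, sub_eq_zero] at hs
      apply hx.1
      rw [← one_mul x, ← hs, mul_assoc, sub_mul, one_mul, hx.2.1.eq, sub_self, mul_zero]
    obtain ⟨j, c, hc⟩ := exists_mul_mul_ne_zero_of_isInternal hB n F φ hφinj hφrange f hfB
      (fun j => (hf j).1) hx0
    obtain ⟨v, hv⟩ := (hf j).exists_mul_eq hc (by rw [mul_assoc, (hf j).2.1.eq])
    obtain ⟨c, rfl⟩ := Ideal.Quotient.mk_surjective c
    obtain ⟨v, rfl⟩ := Ideal.Quotient.mk_surjective v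
    refine ⟨j, hx.finrank_span_eq (u := x * c * e j) (v := v) (he j).2.1 (he j).1
      (by rw [← mul_assoc, ← mul_assoc, hx.2.1.eq]) (by rw [mul_assoc, (he j).2.1.eq]) ?_⟩
    rw [← Ideal.Quotient.eq_zero_iff_mem, map_sub, map_mul, map_mul, map_mul, hef, hv, sub_self]
  tfae_have 1 → 2 := by
    intro h x hx
    have h1 := (h _ ⟨x, hx, rfl⟩).2
    rw [hchar] at h1
    exact le_antisymm h1 (Nat.le_of_dvd (hpos x hx.1)
      (hdvd x hx.2.1))
  tfae_have 2 → 1 := by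
    rintro h _ ⟨x, hx, rfl⟩
    exact ⟨⟨x, hx.2.1, rfl⟩, by rw [h x hx, hchar]⟩
  tfae_have 2 → 3 := by
    intro h j
    have h1 := h (e j) (he j)
    have h2 := hsplit j
    omega
  tfae_have 3 → 2 := by
    intro h x hx
    obtain ⟨j, hj⟩ := hcomp x hx
    have h1 := h j
    have h2 := hsplit j
    omega
  tfae_have 3 ↔ 4 := by
    refine forall_congr' fun j => ?_
    rw [hdim j]
    push_cast
    constructor <;> intro h <;> linarith
  tfae_finish

theorem theorem4p4
    {K : Type*} [Field K] [Finite K] (p : ℕ) [CharP K p]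
    {H : Type*} [Group H] [Finite H] (hpH : p ∣ Nat.card H)
    -- the simple components of `A / J(A)`, where `A` is the group algebra
    {m : ℕ} (B : Fin m → TwoSidedIdeal (MonoidAlgebra K H ⧸ Ring.jacobson (MonoidAlgebra K H)))
    (hB : DirectSum.IsInternal B) (hBsimple : ∀ j, IsSimpleRing (B j))
    -- isomorphisms of `K`-algebras from the matrix algebras onto the simple components
    (n : Fin m → ℕ) (F : Fin m → Type*) [∀ j, Field (F j)] [∀ j, Algebra K (F j)]
    (φ : ∀ j, Matrix (Fin (n j)) (Fin (n j)) (F j) →ₙₐ[K]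
      (MonoidAlgebra K H ⧸ Ring.jacobson (MonoidAlgebra K H)))
    (hφinj : ∀ j, Function.Injective (φ j)) (hφrange : ∀ j, Set.range (φ j) = (B j : Set _))
    -- primitive idempotents of the simple components, lifted to `A`
    (f : Fin m → MonoidAlgebra K H ⧸ Ring.jacobson (MonoidAlgebra K H))
    (hfB : ∀ j, f j ∈ B j) (hf : ∀ j, IsPrimitiveIdempotent (f j))
    (e : Fin m → MonoidAlgebra K H) (he : ∀ j, IsPrimitiveIdempotent (e j))
    (hef : ∀ j, Ideal.Quotient.mk (Ring.jacobson (MonoidAlgebra K H)) (e j) = f j) :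
    List.TFAE [
      IsECID K (MonoidAlgebra K H),
      ∀ x : MonoidAlgebra K H, IsPrimitiveIdempotent x → Module.finrank K (Ideal.span {x}) = p,
      ∀ j, (Module.finrank K (Ideal.span {f j}) : ℤ) =
        (p : ℤ) - Module.finrank K ((Ring.jacobson (MonoidAlgebra K H)).mulElem (e j)),
      ∀ j, (Module.finrank K ((Ring.jacobson (MonoidAlgebra K H)).mulElem (e j)) : ℤ) =
        (p : ℤ) - (n j : ℤ) * Module.finrank K (F j)] := by
  have : Fact p.Prime := ⟨CharP.char_is_prime K p⟩
  exact tfae_isECID p (fun x hx => MonoidAlgebra.dvd_finrank_span_idempotent p hpH hx) B hB n F φ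
    hφinj hφrange f hfB hf e he hef
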